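/- Let $p$ be a prime, $\mathbb{C}_p$ the completion of an algebraic closure of $\mathbb{Q}_p$, and let $q,\lambda\in\mathbb{C}_p$ satisfy $|1-q|_p<1$ and $|1-\lambda|_p<1$, where either $q=1$ or $q$ is not a root of unity. For $|a-1|_p<1$ put $\log a=\sum_{m\ge 1}(-1)^{m-1}(a-1)^m/m$ and, for $x\in\mathbb{Z}_p$, $a^x=\sum_{m\ge 0}\binom{x}{m}(a-1)^m$. Write $(x)_n=x(x-1)\cdots(x-n+1)$, and $[m]_q=\frac{1-q^m}{1-q}$ for $q\neq 1$, $[m]_1=m$. For a Dirichlet character $\chi$ modulo $d\ge 1$ with values in $\mathbb{C}_p$ (for instance a character of conductor $d$), consider, as a formal Laurent series in $t$ over $\mathbb{C}_p$, $$F_{\mathfrak D}(t;q,\lambda,\chi)=\frac{q-1}{\log q}\,\bigl(\log(\lambda+\lambda^2t)+\log q\bigr)\sum_{j=0}^{d-1}\frac{(\lambda q)^j(1+\lambda t)^j\chi(j)}{(\lambda q(1+\lambda t))^d-1},$$ where $\log(\lambda+\lambda^2t)=\log\lambda+\sum_{m\ge1}(-1)^{m-1}\lambda^mt^m/m$ and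 where $\frac{q-1}{\log q}$ is read as its limit $1$ if $q=1$. The generalized Apostol-Daehee number $\mathfrak D_{n,\chi}(\lambda,q)$ ($n\ge0$) is defined as $n!$ times the coefficient of $t^n$ in $F_{\mathfrak D}(t;q,\lambda,\chi)$. Then $F_{\mathfrak D}$ has no terms of negative degree, so that $F_{\mathfrak D}(t;q,\lambda,\chi)=\sum_{n\ge0}\mathfrak D_{n,\chi}(\lambda,q)\frac{t^n}{n!}$, and for every $n\ge 0$ the following holds. 1. If $d=p^k$ for some $k\ge0$, so that $\chi$ is a function on $\mathbb{Z}_p$ through $\mathbb{Z}_p\to\mathbb{Z}/p^k\mathbb{Z}$, then $$\mathfrak D_{n,\chi}(\lambda,q)=\int_{\mathbb{Z}_p}(x)_n\lambda^{x+n}\chi(x)\,d\mu_q(x),\qquad \int_{\mathbb{Z}_p}f(x)\,d\mu_q(x):=\lim_{N\to\infty}\frac1{[p^N]_q}\sum_{x=0}^{p^N-1}f(x)q^x.$$ 2. For arbitrary $d\ge1$, $$\mathfrak D_{n,\chi}(\lambda,q)=\int_{X}(x)_n\lambda^{x+n}\chi(x)\,d\mu_q(x),\qquad \int_{X}f(x)\,d\mu_q(x):=\lim_{N\to\infty}\frac1{[dp^N]_q}\sum_{x=0}^{dp^N-1}f(x)q^x,$$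 where $X=\varprojlim_N\mathbb{Z}/dp^N\mathbb{Z}$, and $x\in X$ enters $(x)_n$ and $\lambda^{x+n}$ through the projection $X\to\mathbb{Z}_p$ and $\chi(x)$ through $X\to\mathbb{Z}/d\mathbb{Z}$. In both cases the existence of the limit is part of the claim. -/

import Mathlib

open Filter Topology

noncomputable section

namespace ApostolDaehee

/-- The `q`-number `[m]_q`, equal to `(1 - q ^ m) / (1 - q)` for `q ≠ 1` and to `m` for `q = 1`. -/
def qBracket {K : Type*} [Field K] [DecidableEq K] (q : K) (m : ℕ) : K :=
  if q = 1 then (m : K) else (1 - q ^ m) / (1 - q)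

section Analytic

variable {p : ℕ} [Fact p.Prime]

/-- The inclusion `ℤ_p ⊆ ℚ_p ⊆ ℂ_p`. -/
def padicIntCast : ℤ_[p] →+* ℂ_[p] :=
  (algebraMap ℚ_[p] ℂ_[p]).comp PadicInt.Coe.ringHom

open scoped Classical in
/-- `f : ℤ_p → ℂ_p` has `p`-adic `q`-Volkenborn integral `I`, that is,
`I = lim_N (1 / [p ^ N]_q) * ∑_{x < p ^ N} f x * q ^ x`. -/
def HasQVolkenbornIntegral (q : ℂ_[p]) (f : ℤ_[p] → ℂ_[p]) (I : ℂ_[p]) : Prop :=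
  Tendsto (fun N : ℕ =>
    1 / qBracket q (p ^ N) * ∑ x ∈ Finset.range (p ^ N), f (x : ℤ_[p]) * q ^ x) atTop (𝓝 I)

/-- The `p`-adic logarithm `log a = ∑_{m ≥ 1} (-1) ^ (m - 1) * (a - 1) ^ m / m`,
used for `‖a - 1‖ < 1`. -/
def padicLog (a : ℂ_[p]) : ℂ_[p] :=
  ∑' m : ℕ, (-1) ^ m * (a - 1) ^ (m + 1) / ((m : ℂ_[p]) + 1)

/-- The `p`-adic power `a ^ x = ∑_m (x choose m) * (a - 1) ^ m` with exponent `x ∈ ℤ_p`,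
used for `‖a - 1‖ < 1`. -/
def padicPow (a : ℂ_[p]) (x : ℤ_[p]) : ℂ_[p] :=
  ∑' m : ℕ, padicIntCast (Ring.choose x m) * (a - 1) ^ m

/-- The falling factorial `(x)_n = x * (x - 1) * ... * (x - n + 1)` of `x ∈ ℤ_p`, in `ℂ_p`. -/
def fallingFactorial (x : ℤ_[p]) (n : ℕ) : ℂ_[p] :=
  padicIntCast ((descPochhammer ℤ_[p] n).eval x)

end Analytic

section LevelSpace

/-- The ring `X = lim_N ℤ / d p ^ N ℤ`, as coherent sequences. -/
def levelSpace (p d : ℕ) : Subring (∀ N : ℕ, ZMod (d * p ^ N)) where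
  carrier := {a | ∀ N : ℕ,
    ZMod.castHom (mul_dvd_mul_left d (pow_dvd_pow p N.le_succ)) (ZMod (d * p ^ N)) (a (N + 1))
      = a N}
  mul_mem' {a b} ha hb N := by
    have h1 := ha N
    have h2 := hb N
    rw [Pi.mul_apply, map_mul, h1, h2, Pi.mul_apply]
  one_mem' N := map_one _
  add_mem' {a b} ha hb N := by
    have h1 := ha N
    have h2 := hb N
    rw [Pi.add_apply, map_add, h1, h2, Pi.add_apply]
  zero_mem' N := map_zero _
  neg_mem' {a} ha N := by
    have h1 := ha N
    rw [Pi.neg_apply, map_neg, h1, Pi.neg_apply]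

variable {p d : ℕ}

/-- The reduction `X → ℤ / p ^ N ℤ`. -/
def levelSpace.toZModPow (N : ℕ) : levelSpace p d →+* ZMod (p ^ N) :=
  (ZMod.castHom (Dvd.intro_left d rfl) (ZMod (p ^ N))).comp
    ((Pi.evalRingHom (fun N : ℕ => ZMod (d * p ^ N)) N).comp (levelSpace p d).subtype)

/-- The reduction `X → ℤ / d ℤ`. -/
def levelSpace.toZMod : levelSpace p d →+* ZMod d :=
  (ZMod.castHom (Dvd.intro _ rfl) (ZMod d)).comp
    ((Pi.evalRingHom (fun N : ℕ => ZMod (d * p ^ N)) 0).comp (levelSpace p d).subtype)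

lemma levelSpace.toZModPow_compat (k₁ k₂ : ℕ) (hk : k₁ ≤ k₂) :
    (ZMod.castHom (pow_dvd_pow p hk) (ZMod (p ^ k₁))).comp (levelSpace.toZModPow (d := d) k₂)
      = levelSpace.toZModPow (d := d) k₁ := by
  induction k₂, hk using Nat.le_induction with
  | base => ext a; simp
  | succ m hm ih =>
    rw [← ih]
    have hstep : levelSpace.toZModPow (p := p) (d := d) m =
        (ZMod.castHom (pow_dvd_pow p m.le_succ) (ZMod (p ^ m))).comp
          (levelSpace.toZModPow (d := d) (m + 1)) := by
      ext a
      have h := a.2 m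
      simp only [levelSpace.toZModPow, RingHom.comp_apply, Subring.subtype_apply,
        Pi.evalRingHom_apply]
      rw [← h, ← RingHom.comp_apply, ← RingHom.comp_apply]
      exact congrFun (congrArg DFunLike.coe (Subsingleton.elim _ _)) _
    rw [hstep, ← RingHom.comp_assoc]
    exact congrArg (fun g => RingHom.comp g _) (Subsingleton.elim _ _)

/-- The projection `X → ℤ_p = lim_N ℤ / p ^ N ℤ`. -/
def levelSpace.toPadicInt [Fact p.Prime] : levelSpace p d →+* ℤ_[p] :=
  PadicInt.lift (f := fun N : ℕ => levelSpace.toZModPow (d := d) N) levelSpace.toZModPow_compat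

open scoped Classical in
/-- `f : X → ℂ_p` on `X = lim_N ℤ / d p ^ N ℤ` has `p`-adic `q`-Volkenborn integral `I`, that is,
`I = lim_N (1 / [d p ^ N]_q) * ∑_{x < d p ^ N} f x * q ^ x`. -/
def HasQVolkenbornIntegralLevel [Fact p.Prime] (q : ℂ_[p]) (f : levelSpace p d → ℂ_[p])
    (I : ℂ_[p]) : Prop :=
  Tendsto (fun N : ℕ =>
    1 / qBracket q (d * p ^ N) *
      ∑ x ∈ Finset.range (d * p ^ N), f (x : levelSpace p d) * q ^ x) atTop (𝓝 I)

end LevelSpace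

section Numbers

variable {p : ℕ} [Fact p.Prime] {d : ℕ}

open scoped Classical in
/-- The factor `(q - 1) / log q`, with its limit value `1` at `q = 1`. -/
def qLogFactor (q : ℂ_[p]) : ℂ_[p] :=
  if q = 1 then 1 else (q - 1) / padicLog q

/-- The formal power series `1 + lam * t`. -/
def oneAddMul (lam : ℂ_[p]) : PowerSeries ℂ_[p] :=
  1 + PowerSeries.C lam * PowerSeries.X

/-- The formal power series
`log (lam + lam ^ 2 * t) = log lam + ∑_{m ≥ 1} (-1) ^ (m - 1) * lam ^ m * t ^ m / m`. -/
def logSeries (lam : ℂ_[p]) : PowerSeries ℂ_[p] :=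
  PowerSeries.C (padicLog lam) + PowerSeries.rescale lam (PowerSeries.log ℂ_[p])

/-- The generating function
`((q - 1) log (lam + lam ^ 2 t) + (q - 1) log q) / log q *
  ∑_{j < d} (lam q) ^ j (1 + lam t) ^ j χ(j) / ((lam q (1 + lam t)) ^ d - 1)`,
expanded as a formal Laurent series in `t` at `t = 0`. -/
def generatingFunction (χ : DirichletCharacter ℂ_[p] d) (lam q : ℂ_[p]) : LaurentSeries ℂ_[p] :=
  ((PowerSeries.C (qLogFactor q) * (logSeries lam + PowerSeries.C (padicLog q)) *
      ∑ j ∈ Finset.range d,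
        PowerSeries.C ((lam * q) ^ j * χ (j : ZMod d)) * oneAddMul lam ^ j :
      PowerSeries ℂ_[p]) : LaurentSeries ℂ_[p]) /
    (((PowerSeries.C (lam * q) * oneAddMul lam) ^ d - 1 :
      PowerSeries ℂ_[p]) : LaurentSeries ℂ_[p])

/-- The generalized Apostol-Daehee number attached to `χ`: `n!` times the coefficient of `t ^ n`
in the generating function. -/
def apostolDaehee (χ : DirichletCharacter ℂ_[p] d) (lam q : ℂ_[p]) (n : ℕ) : ℂ_[p] :=
  (n.factorial : ℂ_[p]) * (generatingFunction χ lam q).coeff (n : ℤ)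

end Numbers

end ApostolDaehee

end

/-! For M = d * p ^ N, the N-th Riemann sum is n! times the t^n-coefficient of S_M / [M]_q, where
S_M = ∑_{j<M} (λq(1+λt))^j χ(j). Put u = λq(1+λt). Periodicity of χ gives (u^d - 1) S_M = (u^M - 1)
S_d (`pow_sub_one_mul_charSum`), so N enters only through (u^M - 1) / [M]_q. Since M tends to 0 in
ℤ_p, (a^M - 1) / M tends to log a (`tendsto_pow_sub_one_div`). Hence (u^M - 1) / [M]_q converges
coefficientwise to (q-1) / log q * (log(λ+λ²t) + log q) (`tendsto_coeff_pow_sub_one`), which is the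
remaining factor of the generating function. It remains to divide by u^d - 1. Its constant term may
vanish, but it is nonzero, so coefficientwise limits survive the division
(`tendsto_coeff_of_tendsto_coeff_mul`). The quotient is a power series because log(λq) = 0 whenever
(λq)^d = 1 (`pow_sub_one_dvd`). -/

noncomputable section

namespace ApostolDaehee

/-! ### Divisibility and coefficientwise limits of formal power series -/

section PowerSeries

open PowerSeries

/-- A nonzero power series over a field divides a power of `X`. -/
theorem exists_mul_eq_X_pow {K : Type*} [Field K] {D : PowerSeries K} (hD : D ≠ 0) :
    ∃ (E : PowerSeries K) (r : ℕ), E * D = X ^ r := by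
  refine ⟨Inv_divided_by_X_pow_order hD, D.order.toNat, ?_⟩
  refine (congrArg (Inv_divided_by_X_pow_order hD * ·) X_pow_order_mul_divXPowOrder.symm).trans ?_
  rw [mul_left_comm, Inv_divided_by_X_pow_order_leftInv, mul_one]

/-- Division by a fixed nonzero power series preserves coefficientwise limits. -/
theorem tendsto_coeff_of_tendsto_coeff_mul {K : Type*} [NormedField K] {D Q : PowerSeries K}
    (hD : D ≠ 0) {F : ℕ → PowerSeries K}
    (h : ∀ n, Tendsto (fun N => coeff n (D * F N)) atTop (𝓝 (coeff n (D * Q)))) (n : ℕ) :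
    Tendsto (fun N => coeff n (F N)) atTop (𝓝 (coeff n Q)) := by
  obtain ⟨E, r, hE⟩ := exists_mul_eq_X_pow hD
  -- Multiplying by `E` turns division by `D` into an index shift by `r`, so each coefficient of `G`
  -- is a fixed finite combination of coefficients of `D * G`.
  have key (G : PowerSeries K) : coeff n G = coeff (n + r) (E * (D * G)) := by
    rw [← mul_assoc, hE, coeff_X_pow_mul]
  simp only [key, coeff_mul (n + r) E]
  exact tendsto_finsetSum _ fun i _ => (h _).const_mul _

/-- A power series with constant coefficient zero and nonzero linear coefficient divides every
power series with constant coefficient zero. -/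
theorem dvd_of_constantCoeff_eq_zero {K : Type*} [Field K] {D A : PowerSeries K}
    (hD : coeff 1 D ≠ 0) (h : constantCoeff D = 0 → constantCoeff A = 0) : D ∣ A := by
  by_cases h0 : constantCoeff D = 0
  · obtain ⟨D', rfl⟩ := X_dvd_iff.2 h0
    obtain ⟨A', rfl⟩ := X_dvd_iff.2 (h h0)
    -- After cancelling `X`, the constant term of `D'` is the linear coefficient of `D`.
    refine mul_dvd_mul_left _ (IsUnit.dvd ?_)
    rw [isUnit_iff_constantCoeff, isUnit_iff_ne_zero]
    simpa using hD
  · exact (isUnit_iff_constantCoeff.2 (isUnit_iff_ne_zero.2 h0)).dvd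

end PowerSeries

/-! ### Norms of natural numbers in ℂ_p -/

section Norm

variable {p : ℕ} [Fact p.Prime]

theorem norm_natCast_padicComplex (n : ℕ) : ‖(n : ℂ_[p])‖ = ‖(n : ℚ_[p])‖ := by
  rw [← map_natCast (algebraMap ℚ_[p] ℂ_[p]), norm_algebraMap']

/-- If n = p^k m with p not dividing m, the norm is p^(-k) and p^k ≤ n. This controls the
denominators of the logarithm series. -/
theorem inv_le_norm_natCast {n : ℕ} (hn : n ≠ 0) : (n : ℝ)⁻¹ ≤ ‖(n : ℂ_[p])‖ := by
  obtain ⟨k, m, hm, rfl⟩ := Nat.exists_eq_pow_mul_and_not_dvd hn p (Fact.out : p.Prime).ne_one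
  have hm0 : 0 < m := Nat.pos_of_ne_zero fun h => hm (h ▸ dvd_zero p)
  have h1 : ‖(m : ℚ_[p])‖ = 1 :=
    Padic.norm_natCast_eq_one_iff.2 ((Nat.Prime.coprime_iff_not_dvd Fact.out).2 hm)
  rw [norm_natCast_padicComplex]
  push_cast
  rw [norm_mul, norm_pow, h1, Padic.norm_p, mul_one, inv_pow]
  have hp : (0 : ℝ) < p := mod_cast (Fact.out : p.Prime).pos
  gcongr
  exact le_mul_of_one_le_right (by positivity) (mod_cast hm0)

theorem norm_pow_div_le (b : ℂ_[p]) (hb : ‖b‖ ≤ 1) (z : ℂ_[p]) (m : ℕ) :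
    ‖b * z ^ (m + 1) / ((m : ℂ_[p]) + 1)‖ ≤ ((m : ℝ) + 1) * ‖z‖ ^ (m + 1) := by
  have h := inv_le_norm_natCast (p := p) m.succ_ne_zero
  have h0 : (0 : ℝ) < ((m : ℝ) + 1)⁻¹ := by positivity
  push_cast at h
  rw [norm_div, norm_mul, norm_pow, div_eq_mul_inv, mul_comm]
  gcongr
  · exact (inv_anti₀ h0 h).trans_eq (inv_inv _)
  · exact mul_le_of_le_one_left (by positivity) hb

theorem tendsto_natCast_mul_pow (d : ℕ) :
    Tendsto (fun N : ℕ => ((d * p ^ N : ℕ) : ℂ_[p])) atTop (𝓝 0) := by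
  have hp : ‖(p : ℂ_[p])‖ < 1 := by
    rw [norm_natCast_padicComplex]; exact Padic.norm_p_lt_one
  simpa using (tendsto_pow_atTop_nhds_zero_of_norm_lt_one hp).const_mul (d : ℂ_[p])

end Norm

/-! ### The p-adic logarithm as a limit of (a^M - 1) / M -/

section Log

variable {p : ℕ} [Fact p.Prime] {M : ℕ → ℕ}

/-- As M tends to 0, the limit is the generalized binomial coefficient of -1 over m. The induction
combines Pascal's rule with M * C(M-1, m) = (m+1) * C(M, m+1). -/
theorem tendsto_choose_sub_one (hM : ∀ N, 0 < M N)
    (h : Tendsto (fun N => (M N : ℂ_[p])) atTop (𝓝 0)) (m : ℕ) :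
    Tendsto (fun N => ((M N - 1).choose m : ℂ_[p])) atTop (𝓝 ((-1) ^ m)) := by
  induction m with
  | zero => simp
  | succ m ih =>
    have key (N : ℕ) : ((M N - 1).choose (m + 1) : ℂ_[p]) =
        (M N : ℂ_[p]) * ((M N - 1).choose m : ℂ_[p]) * ((m : ℂ_[p]) + 1)⁻¹
          - ((M N - 1).choose m : ℂ_[p]) := by
      obtain ⟨r, hr⟩ := Nat.exists_eq_succ_of_ne_zero (hM N).ne'
      have hm : ((m : ℂ_[p]) + 1) ≠ 0 := Nat.cast_add_one_ne_zero m
      have h1 : ((r : ℂ_[p]) + 1) * (r.choose m : ℂ_[p]) =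
          ((r + 1).choose (m + 1) : ℂ_[p]) * ((m : ℂ_[p]) + 1) :=
        mod_cast Nat.add_one_mul_choose_eq r m
      rw [hr, Nat.succ_eq_add_one, Nat.add_sub_cancel, Nat.cast_add_one, h1,
        mul_inv_cancel_right₀ hm, Nat.choose_succ_succ]
      push_cast
      ring
    simp only [key]
    convert ((h.mul ih).mul_const ((m : ℂ_[p]) + 1)⁻¹).sub ih using 2
    ring

/-- Binomial expansion around 1 with C(M, k+1) / M = C(M-1, k) / (k+1). Writing the finite sum as a
series over all k prepares a termwise limit by dominated convergence. -/
theorem pow_sub_one_div_eq_tsum (a : ℂ_[p]) {m : ℕ} (hm : 0 < m) :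
    (a ^ m - 1) / (m : ℂ_[p]) =
      ∑' k : ℕ, ((m - 1).choose k : ℂ_[p]) * (a - 1) ^ (k + 1) / ((k : ℂ_[p]) + 1) := by
  obtain ⟨r, rfl⟩ := Nat.exists_eq_succ_of_ne_zero hm.ne'
  rw [Nat.succ_eq_add_one, Nat.add_sub_cancel]
  have hr : ((r + 1 : ℕ) : ℂ_[p]) ≠ 0 := Nat.cast_ne_zero.2 r.succ_ne_zero
  rw [tsum_eq_sum (s := Finset.range (r + 1)), div_eq_iff hr, Finset.sum_mul]
  · have h := add_pow (a - 1) 1 (r + 1)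
    rw [sub_add_cancel, Finset.sum_range_succ'] at h
    rw [h]
    simp only [one_pow, mul_one, pow_zero, Nat.choose_zero_right, Nat.cast_one, add_sub_cancel_right]
    refine Finset.sum_congr rfl fun k _ => ?_
    have hk : ((k : ℂ_[p]) + 1) ≠ 0 := Nat.cast_add_one_ne_zero k
    have h1 : ((r : ℂ_[p]) + 1) * (r.choose k : ℂ_[p]) =
        ((r + 1).choose (k + 1) : ℂ_[p]) * ((k : ℂ_[p]) + 1) :=
      mod_cast Nat.add_one_mul_choose_eq r k
    rw [div_mul_eq_mul_div, eq_div_iff hk]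
    push_cast
    linear_combination -(a - 1) ^ (k + 1) * h1
  · intro k hk
    rw [Nat.choose_eq_zero_of_lt (by simpa using hk)]
    simp

theorem summable_mul_pow {r : ℝ} (h0 : 0 ≤ r) (h1 : r < 1) :
    Summable fun m : ℕ => ((m : ℝ) + 1) * r ^ (m + 1) := by
  have h := summable_pow_mul_geometric_of_norm_lt_one (R := ℝ) 1
    (r := r) (by rwa [Real.norm_of_nonneg h0])
  simpa using (summable_nat_add_iff 1).2 h

/-- The `p`-adic logarithm is the limit of `(a ^ m - 1) / m` as `m` tends to `0` in `ℤ_p`. -/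
theorem tendsto_pow_sub_one_div {a : ℂ_[p]} (ha : ‖a - 1‖ < 1) (hM : ∀ N, 0 < M N)
    (h : Tendsto (fun N => (M N : ℂ_[p])) atTop (𝓝 0)) :
    Tendsto (fun N => (a ^ M N - 1) / (M N : ℂ_[p])) atTop (𝓝 (padicLog a)) := by
  simp only [fun N => pow_sub_one_div_eq_tsum a (hM N)]
  refine tendsto_tsum_of_dominated_convergence (summable_mul_pow (norm_nonneg _) ha)
    (fun k => ((tendsto_choose_sub_one hM h k).mul_const _).div_const _) ?_
  exact Eventually.of_forall fun N k =>
    norm_pow_div_le _ (IsUltrametricDist.norm_natCast_le_one _ _) _ _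

theorem tendsto_pow_one {a : ℂ_[p]} (ha : ‖a - 1‖ < 1) (hM : ∀ N, 0 < M N)
    (h : Tendsto (fun N => (M N : ℂ_[p])) atTop (𝓝 0)) :
    Tendsto (fun N => a ^ M N) atTop (𝓝 1) := by
  have h1 := ((tendsto_pow_sub_one_div ha hM h).mul h).add_const 1
  rw [mul_zero, zero_add] at h1
  refine h1.congr fun N => ?_
  rw [div_mul_cancel₀ _ (Nat.cast_ne_zero.2 (hM N).ne'), sub_add_cancel]

theorem norm_mul_sub_one_lt {a b : ℂ_[p]} (ha : ‖a - 1‖ < 1) (hb : ‖b - 1‖ < 1) :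
    ‖a * b - 1‖ < 1 := by
  have hb1 : ‖b‖ ≤ 1 := by
    have := IsUltrametricDist.norm_add_le_max (b - 1) 1
    rw [sub_add_cancel, norm_one, max_eq_right hb.le] at this
    exact this
  rw [show a * b - 1 = (a - 1) * b + (b - 1) by ring]
  refine (IsUltrametricDist.norm_add_le_max _ _).trans_lt (max_lt ?_ hb)
  rw [norm_mul]
  exact (mul_le_of_le_one_right (norm_nonneg _) hb1).trans_lt ha

/-- Pass to the limit in (ab)^M - 1 = (a^M - 1) b^M + (b^M - 1), divided by M = p^N, using b^M → 1.
-/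
theorem padicLog_mul {a b : ℂ_[p]} (ha : ‖a - 1‖ < 1) (hb : ‖b - 1‖ < 1) :
    padicLog (a * b) = padicLog a + padicLog b := by
  have hM (N : ℕ) : 0 < 1 * p ^ N := by have := (Fact.out : p.Prime).pos; positivity
  have h := tendsto_natCast_mul_pow (p := p) 1
  refine tendsto_nhds_unique (tendsto_pow_sub_one_div (norm_mul_sub_one_lt ha hb) hM h) ?_
  have h1 := ((tendsto_pow_sub_one_div ha hM h).mul (tendsto_pow_one hb hM h)).add
    (tendsto_pow_sub_one_div hb hM h)
  rw [mul_one] at h1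
  refine h1.congr fun N => ?_
  rw [mul_pow]
  ring

/-- Along the exponents d * p ^ N the approximants of the logarithm are identically zero. -/
theorem padicLog_eq_zero_of_pow_eq_one {a : ℂ_[p]} (ha : ‖a - 1‖ < 1) {d : ℕ} (hd : 0 < d)
    (h : a ^ d = 1) : padicLog a = 0 := by
  have hM (N : ℕ) : 0 < d * p ^ N := by have := (Fact.out : p.Prime).pos; positivity
  refine tendsto_nhds_unique (tendsto_pow_sub_one_div ha hM (tendsto_natCast_mul_pow d)) ?_
  simp [pow_mul, h]

@[simp]
theorem padicLog_one : padicLog (1 : ℂ_[p]) = 0 := by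
  simp [padicLog]

theorem padicLog_pow {a : ℂ_[p]} (ha : ‖a - 1‖ < 1) (m : ℕ) :
    ‖a ^ m - 1‖ < 1 ∧ padicLog (a ^ m) = m * padicLog a := by
  induction m with
  | zero => simp
  | succ m ih =>
    rw [pow_succ]
    refine ⟨norm_mul_sub_one_lt ih.1 ha, ?_⟩
    rw [padicLog_mul ih.1 ha, ih.2]
    push_cast
    ring

/-- The `p`-adic logarithm is injective near `1`. -/
theorem eq_one_of_padicLog_eq_zero {a : ℂ_[p]} (ha : ‖a - 1‖ ≤ 1 / 4) (h : padicLog a = 0) :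
    a = 1 := by
  have hs : Summable fun m : ℕ => (-1) ^ m * (a - 1) ^ (m + 1) / ((m : ℂ_[p]) + 1) :=
    Summable.of_norm_bounded (summable_mul_pow (norm_nonneg _) (by linarith))
      fun m => norm_pow_div_le _ (by simp) _ _
  rw [padicLog, hs.tsum_eq_zero_add] at h
  have h1 : a - 1 = -∑' m : ℕ, (-1) ^ (m + 1) *
      (a - 1) ^ (m + 1 + 1) / (((m + 1 : ℕ) : ℂ_[p]) + 1) := by
    rw [eq_neg_iff_add_eq_zero, ← h]
    simp
  have h2 : ‖a - 1‖ ≤ ‖a - 1‖ / 2 := by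
    conv_lhs => rw [h1]
    rw [norm_neg]
    refine IsUltrametricDist.norm_tsum_le_of_forall_le_of_nonneg (by positivity) fun m => ?_
    refine (norm_pow_div_le _ (by simp) _ _).trans ?_
    -- The radius 1/4 is chosen so that m + 2 ≤ 2^(m+1) still leaves a factor 1/2: every term after
    -- the linear one is at most half of ‖a - 1‖.
    have h3 : ((m : ℝ) + 2) * ‖a - 1‖ ^ (m + 1) ≤ 1 / 2 := by
      calc ((m : ℝ) + 2) * ‖a - 1‖ ^ (m + 1) ≤ 2 ^ (m + 1) * (1 / 4) ^ (m + 1) := by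
            gcongr
            exact_mod_cast Nat.lt_two_pow_self (n := m + 1)
        _ = (1 / 2) ^ (m + 1) := by rw [← mul_pow]; norm_num
        _ ≤ 1 / 2 := pow_le_of_le_one (by norm_num) (by norm_num) m.succ_ne_zero
    push_cast
    rw [pow_succ]
    nlinarith [norm_nonneg (a - 1)]
  have h4 : ‖a - 1‖ = 0 := le_antisymm (by linarith) (norm_nonneg _)
  exact sub_eq_zero.1 (norm_eq_zero.1 h4)

/-- The powers a^(p^N) tend to 1 and so enter the ball of radius 1/4 where the logarithm vanishes
only at 1; log a = 0 would then make a a root of unity. -/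
theorem padicLog_ne_zero {a : ℂ_[p]} (ha : ‖a - 1‖ < 1) (h : ∀ m : ℕ, 0 < m → a ^ m ≠ 1) :
    padicLog a ≠ 0 := by
  intro h0
  have hM (N : ℕ) : 0 < 1 * p ^ N := by have := (Fact.out : p.Prime).pos; positivity
  have ht := (tendsto_pow_one ha hM (tendsto_natCast_mul_pow (p := p) 1)).sub_const 1 |>.norm
  rw [sub_self, norm_zero] at ht
  obtain ⟨N, hN⟩ := (ht.eventually_le_const (show (0 : ℝ) < 1 / 4 by norm_num)).exists
  refine h _ (hM N) (eq_one_of_padicLog_eq_zero hN ?_)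
  rw [(padicLog_pow ha _).2, h0, mul_zero]

end Log

/-! ### The integrand at natural numbers -/

section Interpolation

variable {p : ℕ} [Fact p.Prime]

@[simp]
theorem fallingFactorial_natCast (x n : ℕ) :
    fallingFactorial (x : ℤ_[p]) n = (x.descFactorial n : ℂ_[p]) := by
  rw [fallingFactorial, descPochhammer_eval_eq_descFactorial, map_natCast]

@[simp]
-- The Riemann sums sample only natural numbers, where the series terminates and is the binomial
-- theorem.
theorem padicPow_natCast (a : ℂ_[p]) (x : ℕ) : padicPow a (x : ℤ_[p]) = a ^ x := by
  have h := add_pow (a - 1) 1 x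
  rw [sub_add_cancel] at h
  rw [padicPow, h, tsum_eq_sum (s := Finset.range (x + 1))]
  · refine Finset.sum_congr rfl fun m _ => ?_
    rw [Ring.choose_natCast, map_natCast, one_pow, mul_one, mul_comm]
  · intro m hm
    rw [Ring.choose_natCast, Nat.choose_eq_zero_of_lt (by simpa using hm)]
    simp

end Interpolation

/-! ### The generating function and the limit of the Riemann sums -/

section GeneratingFunction

open PowerSeries

variable {p : ℕ} [Fact p.Prime] {d : ℕ} {q lam : ℂ_[p]}

theorem coeff_oneAddMul_pow (lam : ℂ_[p]) (m n : ℕ) :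
    coeff n (oneAddMul lam ^ m) = lam ^ n * (m.choose n : ℂ_[p]) := by
  have h : oneAddMul lam = rescale lam (((1 + Polynomial.X : Polynomial ℂ_[p])) : ℂ_[p]⟦X⟧) := by
    simp [oneAddMul, rescale_X]
  rw [h, ← map_pow, coeff_rescale, ← Polynomial.coe_pow, Polynomial.coeff_coe,
    Polynomial.coeff_one_add_X_pow]

/-- The character sum `∑_{j < m} (lam q) ^ j (1 + lam t) ^ j χ(j)`; for `m = d` it occurs in the
generating function. -/
def charSum (χ : DirichletCharacter ℂ_[p] d) (lam q : ℂ_[p]) (m : ℕ) : ℂ_[p]⟦X⟧ :=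
  ∑ j ∈ Finset.range m, C ((lam * q) ^ j * χ (j : ZMod d)) * oneAddMul lam ^ j

/-- χ has period d, so the sum of length d * m is the sum of length d times a geometric series with
ratio u^d, where u = λq(1+λt). -/
theorem pow_sub_one_mul_charSum (χ : DirichletCharacter ℂ_[p] d) (lam q : ℂ_[p]) (m : ℕ) :
    ((C (lam * q) * oneAddMul lam) ^ d - 1) * charSum χ lam q (d * m) =
      ((C (lam * q) * oneAddMul lam) ^ (d * m) - 1) * charSum χ lam q d := by
  induction m with
  | zero => simp [charSum]
  | succ m ih =>
    have h : charSum χ lam q (d * (m + 1)) = charSum χ lam q (d * m) +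
        (C (lam * q) * oneAddMul lam) ^ (d * m) * charSum χ lam q d := by
      rw [charSum, mul_add_one, Finset.sum_range_add, charSum, charSum, Finset.mul_sum]
      congr 1
      refine Finset.sum_congr rfl fun j _ => ?_
      rw [show ((d * m + j : ℕ) : ZMod d) = (j : ZMod d) by simp,
        mul_pow (C (lam * q)),
        pow_add (lam * q), pow_add (oneAddMul lam), mul_assoc ((lam * q) ^ (d * m)),
        map_mul C ((lam * q) ^ (d * m)), map_pow]
      ring
    rw [h, mul_add, ih, mul_add_one, pow_add]
    ring

theorem factorial_mul_coeff_charSum (χ : DirichletCharacter ℂ_[p] d) (lam q : ℂ_[p]) (m n : ℕ) :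
    (n.factorial : ℂ_[p]) * coeff n (charSum χ lam q m) =
      ∑ x ∈ Finset.range m,
        (x.descFactorial n : ℂ_[p]) * lam ^ (x + n) * χ (x : ZMod d) * q ^ x := by
  rw [charSum, map_sum, Finset.mul_sum]
  refine Finset.sum_congr rfl fun x _ => ?_
  rw [coeff_C_mul, coeff_oneAddMul_pow, Nat.descFactorial_eq_factorial_mul_choose]
  push_cast
  ring

theorem padicLog_ne_zero_of_ne_one (hq : ‖q - 1‖ < 1)
    (hroot : ∀ m : ℕ, 0 < m → q ^ m = 1 → q = 1) (h1 : q ≠ 1) : padicLog q ≠ 0 :=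
  padicLog_ne_zero hq fun m hm h => h1 (hroot m hm h)

theorem constantCoeff_logSeries (lam : ℂ_[p]) : constantCoeff (logSeries lam) = padicLog lam := by
  rw [← coeff_zero_eq_constantCoeff_apply, logSeries, map_add, coeff_rescale]
  simp [-coeff_zero_eq_constantCoeff, coeff_log]

-- This trades the normalization by [M]_q for division by M. For q ≠ 1 the quotient is (q - 1)
-- divided by (q^M - 1) / M; `hroot` keeps the denominators and their limit log q nonzero.
open scoped Classical in
theorem tendsto_div_qBracket (hq : ‖q - 1‖ < 1) (hroot : ∀ m : ℕ, 0 < m → q ^ m = 1 → q = 1)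
    {M : ℕ → ℕ} (hM : ∀ N, 0 < M N) (h : Tendsto (fun N => (M N : ℂ_[p])) atTop (𝓝 0)) :
    Tendsto (fun N => (M N : ℂ_[p]) / qBracket q (M N)) atTop (𝓝 (qLogFactor q)) := by
  have hM0 (N : ℕ) : (M N : ℂ_[p]) ≠ 0 := Nat.cast_ne_zero.2 (hM N).ne'
  by_cases h1 : q = 1
  · simp [qBracket, qLogFactor, h1, hM0]
  · simp only [qBracket, qLogFactor, if_neg h1]
    refine ((tendsto_const_nhds (x := q - 1)).div (tendsto_pow_sub_one_div hq hM h)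
      (padicLog_ne_zero_of_ne_one hq hroot h1)).congr fun N => ?_
    have h2 : 1 - q ≠ 0 := sub_ne_zero.2 (Ne.symm h1)
    have h3 : 1 - q ^ M N ≠ 0 := sub_ne_zero.2 fun h => h1 (hroot _ (hM N) h.symm)
    have h4 : q ^ M N - 1 ≠ 0 := sub_ne_zero.2 fun h => h1 (hroot _ (hM N) h)
    have := hM0 N
    rw [Pi.div_apply]
    field_simp
    ring

-- In degree 0 the limit is that of ((λq)^M - 1) / M, namely log λ + log q. In degree m + 1 it comes
-- from C(M, m+1) / M = C(M-1, m) / (m+1), with (λq)^M → 1.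
open scoped Classical in
theorem tendsto_coeff_pow_sub_one (hq : ‖q - 1‖ < 1)
    (hroot : ∀ m : ℕ, 0 < m → q ^ m = 1 → q = 1) (hlam : ‖lam - 1‖ < 1)
    {M : ℕ → ℕ} (hM : ∀ N, 0 < M N) (h : Tendsto (fun N => (M N : ℂ_[p])) atTop (𝓝 0)) (n : ℕ) :
    Tendsto (fun N => coeff n
        (C (1 / qBracket q (M N)) * ((C (lam * q) * oneAddMul lam) ^ M N - 1))) atTop
      (𝓝 (coeff n (C (qLogFactor q) * (logSeries lam + C (padicLog q))))) := by
  have hM0 (N : ℕ) : (M N : ℂ_[p]) ≠ 0 := Nat.cast_ne_zero.2 (hM N).ne'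
  have hB := tendsto_div_qBracket hq hroot hM h
  have ha := norm_mul_sub_one_lt hlam hq
  simp only [coeff_C_mul, map_sub, mul_pow, ← map_pow C, coeff_oneAddMul_pow]
  cases n with
  | zero =>
    have h1 := hB.mul (tendsto_pow_sub_one_div ha hM h)
    rw [padicLog_mul hlam hq] at h1
    convert h1 using 2 with N
    · have := hM0 N
      simp only [pow_zero, Nat.choose_zero_right, Nat.cast_one, mul_one, coeff_zero_one]
      rw [mul_pow]
      field_simp
    · simp [constantCoeff_logSeries]
  | succ m =>
    have h1 := hB.mul (((tendsto_pow_one ha hM h).mul_const (lam ^ (m + 1))).mul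
      ((tendsto_choose_sub_one hM h m).div_const ((m : ℂ_[p]) + 1)))
    convert h1 using 2 with N
    · obtain ⟨r, hr⟩ := Nat.exists_eq_succ_of_ne_zero (hM N).ne'
      have hm : ((m : ℂ_[p]) + 1) ≠ 0 := Nat.cast_add_one_ne_zero m
      have h2 : ((r : ℂ_[p]) + 1) * (r.choose m : ℂ_[p]) =
          ((r + 1).choose (m + 1) : ℂ_[p]) * ((m : ℂ_[p]) + 1) :=
        mod_cast Nat.add_one_mul_choose_eq r m
      rw [hr, Nat.succ_eq_add_one, Nat.add_sub_cancel, coeff_one, if_neg m.succ_ne_zero, sub_zero,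
        (eq_div_iff hm).2 h2.symm, mul_pow]
      push_cast
      ring
    · simp [logSeries, coeff_log, pow_add]

theorem coeff_one_pow_sub_one_ne_zero (hd : 0 < d) (hq : q ≠ 0) (hlam : lam ≠ 0) :
    coeff 1 ((C (lam * q) * oneAddMul lam) ^ d - 1) ≠ 0 := by
  rw [mul_pow, ← map_pow, map_sub, coeff_C_mul, coeff_oneAddMul_pow]
  simp [coeff_one, hd.ne', hq, hlam]

/-- The divisor has at most a simple zero at t = 0. If it has one, (λq)^d = 1, so log λ + log q = 0
and the logarithmic factor vanishes there too. -/
theorem pow_sub_one_dvd (χ : DirichletCharacter ℂ_[p] d) (hd : 0 < d) (hq : ‖q - 1‖ < 1)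
    (hlam : ‖lam - 1‖ < 1) :
    (C (lam * q) * oneAddMul lam) ^ d - 1 ∣
      C (qLogFactor q) * (logSeries lam + C (padicLog q)) * charSum χ lam q d := by
  have hne {a : ℂ_[p]} (ha : ‖a - 1‖ < 1) : a ≠ 0 := by rintro rfl; simp at ha
  refine dvd_of_constantCoeff_eq_zero (coeff_one_pow_sub_one_ne_zero hd (hne hq) (hne hlam)) ?_
  intro h
  have h1 : (lam * q) ^ d = 1 := by simpa [oneAddMul, sub_eq_zero] using h
  have h2 := padicLog_eq_zero_of_pow_eq_one (norm_mul_sub_one_lt hlam hq) hd h1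
  rw [padicLog_mul hlam hq] at h2
  have h3 : constantCoeff (logSeries lam + C (padicLog q)) = 0 := by
    rw [map_add, constantCoeff_logSeries, constantCoeff_C, h2]
  rw [map_mul, map_mul, h3, mul_zero, zero_mul]

theorem exists_powerSeries_eq_generatingFunction (χ : DirichletCharacter ℂ_[p] d) (hd : 0 < d)
    (hq : ‖q - 1‖ < 1) (hlam : ‖lam - 1‖ < 1) :
    ∃ Q : ℂ_[p]⟦X⟧, generatingFunction χ lam q = (Q : LaurentSeries ℂ_[p]) ∧
      (C (lam * q) * oneAddMul lam) ^ d - 1 ≠ 0 ∧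
      C (qLogFactor q) * (logSeries lam + C (padicLog q)) * charSum χ lam q d =
        ((C (lam * q) * oneAddMul lam) ^ d - 1) * Q := by
  have hne {a : ℂ_[p]} (ha : ‖a - 1‖ < 1) : a ≠ 0 := by rintro rfl; simp at ha
  have hD : (C (lam * q) * oneAddMul lam) ^ d - 1 ≠ 0 := fun h =>
    coeff_one_pow_sub_one_ne_zero hd (hne hq) (hne hlam) (by rw [h, map_zero])
  obtain ⟨Q, hQ⟩ := pow_sub_one_dvd χ hd hq hlam
  refine ⟨Q, ?_, hD, hQ⟩
  have hD' : (((C (lam * q) * oneAddMul lam) ^ d - 1 : ℂ_[p]⟦X⟧) : LaurentSeries ℂ_[p]) ≠ 0 :=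
    (map_ne_zero_iff _ HahnSeries.ofPowerSeries_injective).2 hD
  rw [generatingFunction, div_eq_iff hD', mul_comm (Q : LaurentSeries ℂ_[p]),
    ← PowerSeries.coe_mul]
  exact congrArg _ hQ

theorem generatingFunction_eq_coe_mk (χ : DirichletCharacter ℂ_[p] d) (hd : 0 < d)
    (hq : ‖q - 1‖ < 1) (hlam : ‖lam - 1‖ < 1) :
    generatingFunction χ lam q =
      ((PowerSeries.mk fun n : ℕ => apostolDaehee χ lam q n / (n.factorial : ℂ_[p]) :
        ℂ_[p]⟦X⟧) : LaurentSeries ℂ_[p]) := by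
  obtain ⟨Q, hQ, -⟩ := exists_powerSeries_eq_generatingFunction χ hd hq hlam
  rw [hQ]
  congr 1
  ext n
  rw [coeff_mk, apostolDaehee, hQ, LaurentSeries.coeff_coe_powerSeries,
    mul_div_cancel_left₀ _ (Nat.cast_ne_zero.2 n.factorial_ne_zero)]

open scoped Classical in
theorem tendsto_sum_apostolDaehee (χ : DirichletCharacter ℂ_[p] d) (hd : 0 < d)
    (hq : ‖q - 1‖ < 1) (hroot : ∀ m : ℕ, 0 < m → q ^ m = 1 → q = 1) (hlam : ‖lam - 1‖ < 1)
    (n : ℕ) :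
    Tendsto (fun N : ℕ => 1 / qBracket q (d * p ^ N) * ∑ x ∈ Finset.range (d * p ^ N),
        (x.descFactorial n : ℂ_[p]) * lam ^ (x + n) * χ (x : ZMod d) * q ^ x) atTop
      (𝓝 (apostolDaehee χ lam q n)) := by
  obtain ⟨Q, hQ, hD, hDQ⟩ := exists_powerSeries_eq_generatingFunction χ hd hq hlam
  have hM (N : ℕ) : 0 < d * p ^ N := by have := (Fact.out : p.Prime).pos; positivity
  rw [apostolDaehee, hQ, LaurentSeries.coeff_coe_powerSeries]
  have hsum (N : ℕ) := factorial_mul_coeff_charSum χ lam q (d * p ^ N) n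
  simp only [← hsum, mul_left_comm _ (n.factorial : ℂ_[p])]
  refine Tendsto.const_mul _ ?_
  simp only [← coeff_C_mul n (charSum χ lam q _)]
  refine tendsto_coeff_of_tendsto_coeff_mul hD (fun m => ?_) n
  -- After multiplication by the denominator, the growing character sum is replaced by the fixed one
  -- of length `d`.
  have key (N : ℕ) : ((C (lam * q) * oneAddMul lam) ^ d - 1) *
        (C (1 / qBracket q (d * p ^ N)) * charSum χ lam q (d * p ^ N)) =
      C (1 / qBracket q (d * p ^ N)) * ((C (lam * q) * oneAddMul lam) ^ (d * p ^ N) - 1) *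
        charSum χ lam q d := by
    rw [mul_left_comm, pow_sub_one_mul_charSum, mul_assoc]
  simp only [key, ← hDQ]
  rw [coeff_mul]
  simp only [coeff_mul m]
  exact tendsto_finsetSum _ fun i _ => (tendsto_coeff_pow_sub_one hq hroot hlam hM
    (tendsto_natCast_mul_pow d) _).mul_const _

end GeneratingFunction

end ApostolDaehee

end

theorem mainTheorem1 (p : ℕ) [Fact p.Prime] (q lam : ℂ_[p])
    (hq : ‖1 - q‖ < 1) (hq_root : ∀ m : ℕ, 0 < m → q ^ m = 1 → q = 1)
    (hlam : ‖1 - lam‖ < 1) :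
    -- the generating function is a power series, with coefficients `𝔇_{n,χ}(lam, q) / n!`
    (∀ (d : ℕ) (_ : 0 < d) (χ : DirichletCharacter ℂ_[p] d),
      ApostolDaehee.generatingFunction χ lam q =
        ((PowerSeries.mk fun n : ℕ =>
            ApostolDaehee.apostolDaehee χ lam q n / (n.factorial : ℂ_[p]) :
          PowerSeries ℂ_[p]) : LaurentSeries ℂ_[p])) ∧
    -- characters modulo a power of `p`: integral over `ℤ_p`
    (∀ (k : ℕ) (χ : DirichletCharacter ℂ_[p] (p ^ k)) (n : ℕ),
      ApostolDaehee.HasQVolkenbornIntegral q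
        (fun x : ℤ_[p] =>
          ApostolDaehee.fallingFactorial x n * ApostolDaehee.padicPow lam (x + (n : ℤ_[p])) *
            χ (PadicInt.toZModPow k x))
        (ApostolDaehee.apostolDaehee χ lam q n)) ∧
    -- arbitrary characters: integral over `X = lim_N ℤ / d p ^ N ℤ`
    (∀ (d : ℕ) (_ : 0 < d) (χ : DirichletCharacter ℂ_[p] d) (n : ℕ),
      ApostolDaehee.HasQVolkenbornIntegralLevel q
        (fun x : ApostolDaehee.levelSpace p d =>
          ApostolDaehee.fallingFactorial (ApostolDaehee.levelSpace.toPadicInt x) n *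
           
            ApostolDaehee.padicPow lam ((ApostolDaehee.levelSpace.toPadicInt x) + (n : ℤ_[p])) * χ (ApostolDaehee.levelSpace.toZMod x))
        (ApostolDaehee.apostolDaehee χ lam q n)) := by
  rw [norm_sub_rev] at hq hlam
  refine ⟨fun d hd χ => ApostolDaehee.generatingFunction_eq_coe_mk χ hd hq hlam,
    fun k χ n => ?_, fun d hd χ n => ?_⟩
  · have h := ApostolDaehee.tendsto_sum_apostolDaehee χ
      (pow_pos (Fact.out : p.Prime).pos k) hq hq_root hlam n
    -- Level N for the modulus d = p^k is level N + k over ℤ_p, since p^k * p^N = p^(N+k); dropping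
    -- the first k terms does not affect the limit.
    rw [ApostolDaehee.HasQVolkenbornIntegral, ← tendsto_add_atTop_iff_nat k]
    refine h.congr fun N => ?_
    simp only [map_natCast, ← Nat.cast_add, ApostolDaehee.fallingFactorial_natCast,
      ApostolDaehee.padicPow_natCast, pow_add p N k, mul_comm (p ^ N)]
  · refine (ApostolDaehee.tendsto_sum_apostolDaehee χ hd hq hq_root hlam n).congr fun N => ?_
    simp only [map_natCast, ← Nat.cast_add, ApostolDaehee.fallingFactorial_natCast,
      ApostolDaehee.padicPow_natCast]
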